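/- Let $\Omega\subset\mathbb R^2$ be a bounded open set with $C^1$ boundary, let $\mathcal H^1$ be the one-dimensional Hausdorff measure, and let $\|\cdot\|$ and $(\cdot|\cdot)$ denote the norm and the scalar product of $L^2(\Omega)$ or $L^2(\Omega;\mathbb R^2)$. For $u\in SBV(\Omega)$ (special functions of bounded variation) let $\nabla u$ be its (approximate) gradient, i.e. the density of the absolutely continuous part of the distributional derivative, and let $S(u)$ be the set of points of $\Omega$ at which $u$ has no approximate limit. For $S\subset\Omega$ with $\mathcal H^1(S)<+\infty$ let $SBV^2(\Omega,S)$ be the set of $u\in SBV(\Omega)\cap L^2(\Omega)$ with $\nabla u\in L^2(\Omega;\mathbb R^2)$ and $\mathcal H^1(S(u)\setminus S)=0$, and let $SBV^2_0(\Omega,S)$ be the set of $u\in SBV^2(\Omega,S)$ whose trace vanishes $\mathcal H^1$-a.e. on $\partial\Omega$. Put $\mathcal F(u,S):=\|\nabla u\|^2+\mathcal H^1(S)$ and $$|\partial\mathcal F|(u,S):=\limsup_{v\to u}\frac{(\mathcal F(u,S)-\mathcal F(v,S\cup S(v)))^+}{\|v-u\|},$$ where $v\in SBV(\Omega)$, $v\neq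 u$, and $v\to u$ in $L^2(\Omega)$; let $|\partial\mathcal F|_b(u,S)$ be the same upper limit restricted to those $v$ whose trace agrees with that of $u$ $\mathcal H^1$-a.e. on $\partial\Omega$. Let $S\subset\Omega$ with $\mathcal H^1(S)<+\infty$ and let $u\in SBV^2(\Omega,S)$. If $|\partial\mathcal F|_b(u,S)<+\infty$, then there exists $f\in L^2(\Omega)$ such that $$(\nabla u|\nabla\varphi)=(f|\varphi)\qquad\text{for all }\varphi\in SBV^2_0(\Omega,S),$$ and $2\|f\|\le|\partial\mathcal F|_b(u,S)$. If, in addition, $|\partial\mathcal F|(u,S)<+\infty$, then, with the same $f$, also $$(\nabla u|\nabla\varphi)=(f|\varphi)\qquad\text{for all }\varphi\in SBV^2(\Omega,S).$$ -/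

import Mathlib

open MeasureTheory Filter Topology Set Metric
open scoped ENNReal ContDiff RealInnerProductSpace

namespace MumfordShah

/-- The Euclidean plane. -/
abbrev Plane : Type := EuclideanSpace ℝ (Fin 2)

/-- The Hilbert space `L²(Ω)` of classes of real functions. -/
abbrev L2 (Ω : Set Plane) : Type := Lp ℝ 2 ((volume : Measure Plane).restrict Ω)

/-- `Ω` has a `C¹` boundary: near each boundary point, after a rigid change of the axes,
`Ω` is the strict epigraph of a `C¹` function of one variable. -/
def HasC1Boundary (Ω : Set Plane) : Prop :=
  ∀ x ∈ frontier Ω, ∃ r > (0 : ℝ), ∃ e : Plane ≃ₗᵢ[ℝ] Plane, ∃ γ : ℝ → ℝ,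
    ContDiff ℝ 1 γ ∧ ∀ y ∈ ball x r, (y ∈ Ω ↔ γ (e y 0) < e y 1)

/-- The distributional derivative of `u` on `Ω` is the finite vector measure
`g ℒ² + ψ ℋ¹`, with `g` integrable for the Lebesgue measure and `ψ` integrable for the
one-dimensional Hausdorff measure, that is
`∫ u ∇φ dx = - ∫ φ g dx - ∫ φ ψ dℋ¹` for all test functions `φ`. Since `ψ` vanishes outside a
set which is `σ`-finite for `ℋ¹`, hence Lebesgue negligible, `g ℒ²` is the absolutely
continuous part of the derivative and `ψ ℋ¹` is its singular part. -/
def HasDerivParts (Ω : Set Plane) (u : Plane → ℝ) (g ψ : Plane → Plane) : Prop :=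
  IntegrableOn g Ω volume ∧ IntegrableOn ψ Ω (μH[1]) ∧
    ∀ φ : Plane → ℝ, ContDiff ℝ ∞ φ → HasCompactSupport φ → tsupport φ ⊆ Ω →
      ∫ x in Ω, u x • gradient φ x =
        -(∫ x in Ω, φ x • g x) - ∫ x in Ω, φ x • ψ x ∂(μH[1])

/-- Special functions with bounded variation on `Ω` (De Giorgi and Ambrosio): integrable
functions whose distributional derivative is a finite measure of the form `g ℒ² + ψ ℋ¹`,
i.e. without Cantor part. -/
def IsSBV (Ω : Set Plane) (u : Plane → ℝ) : Prop :=
  IntegrableOn u Ω volume ∧ ∃ g ψ : Plane → Plane, HasDerivParts Ω u g ψ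

open Classical in
/-- The (approximate) gradient `∇u` of `u ∈ SBV(Ω)`: the density, with respect to the Lebesgue
measure, of the absolutely continuous part of the distributional derivative of `u`. It is
determined almost everywhere on `Ω`. (Value `0` if `u` is not in `SBV(Ω)`.) -/
noncomputable def grad (Ω : Set Plane) (u : Plane → ℝ) : Plane → Plane :=
  if h : IsSBV Ω u then h.2.choose else 0

/-- `z` is the approximate limit of `u` at `x`. -/
def HasApproxLimit (u : Plane → ℝ) (x : Plane) (z : ℝ) : Prop :=
  Tendsto (fun r : ℝ => ⨍ y in ball x r, |u y - z|) (𝓝[>] 0) (𝓝 0)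

/-- The set `S(u)` of the points of `Ω` where `u` has no approximate limit. -/
def discSet (Ω : Set Plane) (u : Plane → ℝ) : Set Plane :=
  {x ∈ Ω | ¬ ∃ z : ℝ, HasApproxLimit u x z}

/-- `A ⊆ B` up to an `ℋ¹`-negligible set. -/
def SubsetH1 (A B : Set Plane) : Prop := μH[1] (A \ B) = 0

/-- `a` is the (inner) trace at the boundary point `x` of the function `u` defined on `Ω`. -/
def HasTraceAt (Ω : Set Plane) (u : Plane → ℝ) (x : Plane) (a : ℝ) : Prop :=
  Tendsto (fun r : ℝ => (r ^ 2)⁻¹ * ∫ y in Ω ∩ ball x r, |u y - a|) (𝓝[>] 0) (𝓝 0)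

/-- `v = u` on `∂Ω`: the traces of `v` and `u` agree `ℋ¹`-almost everywhere on `∂Ω`. -/
def TraceEq (Ω : Set Plane) (v u : Plane → ℝ) : Prop :=
  ∀ᵐ x ∂((μH[1] : Measure Plane).restrict (frontier Ω)),
    ∀ a : ℝ, HasTraceAt Ω v x a ↔ HasTraceAt Ω u x a

/-- `SBV²(Ω, S)`: the functions `u ∈ SBV(Ω) ∩ L²(Ω)` with `∇u ∈ L²(Ω; ℝ²)` and `S(u) ⊆ S` up to
an `ℋ¹`-negligible set. -/
def SBV2 (Ω S : Set Plane) : Set (L2 Ω) :=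
  {u | IsSBV Ω u ∧ MemLp (grad Ω u) 2 (volume.restrict Ω) ∧ SubsetH1 (discSet Ω u) S}

/-- `SBV²₀(Ω, S)`: the functions of `SBV²(Ω, S)` whose trace vanishes `ℋ¹`-almost everywhere
on `∂Ω`. -/
def SBV2Zero (Ω S : Set Plane) : Set (L2 Ω) :=
  {u ∈ SBV2 Ω S |
    ∀ᵐ x ∂((μH[1] : Measure Plane).restrict (frontier Ω)), HasTraceAt Ω u x 0}

/-- The scalar product `(∇u | ∇v)` in `L²(Ω; ℝ²)`. -/
noncomputable def gradInner (Ω : Set Plane) (u v : Plane → ℝ) : ℝ :=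
  ∫ x in Ω, ⟪grad Ω u x, grad Ω v x⟫

/-- The Mumford-Shah functional `F(u, S) = ‖∇u‖² + ℋ¹(S)`, for `u ∈ SBV(Ω)`, with values
in `[0, ∞]`. -/
noncomputable def energy (Ω : Set Plane) (u : Plane → ℝ) (S : Set Plane) : ℝ≥0∞ :=
  (∫⁻ x in Ω, ‖grad Ω u x‖ₑ ^ 2) + μH[1] S

/-- The difference quotient `(F(u, S) - F(v, S ∪ S(v)))⁺ / ‖v - u‖`; subtraction in `[0, ∞]` is
truncated at `0`, so it is the positive part. -/
noncomputable def quotient (Ω S : Set Plane) (u v : L2 Ω) : ℝ≥0∞ :=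
  (energy Ω u S - energy Ω v (S ∪ discSet Ω v)) / ‖v - u‖ₑ

/-- The unilateral slope `|∂F|(u, S)`: the upper limit of the difference quotients as
`v → u` in `L²(Ω)`, `v ∈ SBV(Ω)`, `v ≠ u`. -/
noncomputable def slope (Ω S : Set Plane) (u : L2 Ω) : ℝ≥0∞ :=
  limsup (quotient Ω S u) (𝓝[{v : L2 Ω | IsSBV Ω v ∧ v ≠ u}] u)

/-- The unilateral slope `|∂F|_b(u, S)` with boundary conditions: the same upper limit, taken
only over those `v` that agree with `u` on `∂Ω` in the sense of traces. -/
noncomputable def slopeB (Ω S : Set Plane) (u : L2 Ω) : ℝ≥0∞ :=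
  limsup (quotient Ω S u) (𝓝[{v : L2 Ω | IsSBV Ω v ∧ TraceEq Ω v u ∧ v ≠ u}] u)

end MumfordShah

namespace MumfordShah

/-! ### Sets of finite one-dimensional measure are Lebesgue negligible -/

/-! Test the slope along lines `v = u + tφ`, `t ↓ 0`. If `φ ∈ SBV²(Ω, S)`, then `S(v)` adds no
length to `S`, the finite term `ℋ¹(S)` cancels, and the quotient is exactly `(-2(∇u|∇φ) - t‖∇φ‖²)⁺ /
‖φ‖` (`quotient_add_smul`). Letting `t ↓ 0`, for `φ` and `-φ`, gives `2|(∇u|∇φ)| ≤ slope · ‖φ‖`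
(`two_mul_abs_gradInner_le`). If `φ` has zero trace, `v` keeps the trace of `u`, so the constrained
slope suffices. Hahn-Banach and Riesz then give `f` with its norm bound.

If the free slope is finite too, the same argument on `SBV²(Ω, S)` gives some `f'`. The difference
`f' - f` is orthogonal to `SBV²₀(Ω, S)`, which is dense because it contains the test functions;
hence `f' = f`.

The groundwork is the linearity of `∇`. As `grad` is a chosen density, this needs uniqueness of the
absolutely continuous part (`HasDerivParts.ae_eq`). -/

theorem volume_eq_zero_of_hausdorffMeasure_one_lt_top {A : Set Plane} (hA : μH[1] A < ⊤) :
    volume A = 0 := by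
  have h2 : μH[2] A = 0 :=
    (Measure.hausdorffMeasure_zero_or_top (by norm_num : (1 : ℝ) < 2) A).resolve_right hA.ne
  -- For the sup norm, `ℋ²` on `Fin 2 → ℝ` is Lebesgue measure; the Lipschitz change of norm carries
  -- the null set there.
  have h3 := (PiLp.lipschitzWith_ofLp 2 (fun _ : Fin 2 => ℝ)).hausdorffMeasure_image_le
    (d := 2) (by norm_num) A
  rw [h2, mul_zero] at h3
  have h4 : (volume : Measure (Fin 2 → ℝ)) (WithLp.ofLp '' A) = 0 := by
    rw [← hausdorffMeasure_pi_real]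
    simpa using h3
  refine measure_mono_null (subset_preimage_image (WithLp.ofLp (p := 2)) A) ?_
  exact (PiLp.volume_preserving_ofLp (Fin 2)).quasiMeasurePreserving.preimage_null h4

/-! ### Products with test functions -/

theorem continuous_gradient {φ : Plane → ℝ} (h : ContDiff ℝ ∞ φ) : Continuous (gradient φ) := by
  unfold gradient
  exact (LinearIsometryEquiv.continuous _).comp (h.continuous_fderiv (by simp))

theorem hasCompactSupport_gradient {φ : Plane → ℝ} (h : HasCompactSupport φ) :
    HasCompactSupport (gradient φ) := by
  unfold gradient
  exact (h.fderiv (𝕜 := ℝ)).comp_left (g := (InnerProductSpace.toDual ℝ Plane).symm) (map_zero _)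

theorem integrable_test_smul {μ : Measure Plane} {g : Plane → Plane}
    (hg : Integrable g μ) {φ : Plane → ℝ} (h : ContDiff ℝ ∞ φ) (hc : HasCompactSupport φ) :
    Integrable (fun x => φ x • g x) μ := by
  obtain ⟨C, hC⟩ := hc.exists_bound_of_continuous h.continuous
  exact hg.bdd_smul C h.continuous.aestronglyMeasurable (Eventually.of_forall hC)

theorem integrable_smul_gradient {μ : Measure Plane} {u : Plane → ℝ}
    (hu : Integrable u μ) {φ : Plane → ℝ} (h : ContDiff ℝ ∞ φ)
    (hc : HasCompactSupport φ) : Integrable (fun x => u x • gradient φ x) μ := by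
  obtain ⟨C, hC⟩ := (hasCompactSupport_gradient hc).exists_bound_of_continuous
    (continuous_gradient h)
  exact hu.smul_bdd C (continuous_gradient h).aestronglyMeasurable (Eventually.of_forall hC)

/-! ### Uniqueness of the absolutely continuous part of the derivative -/

/-- The two measures live on disjoint sets: `A = {ψ ≠ 0}` is Lebesgue null. Gluing `ψ` on `A` to `g`
off `A` gives one function, integrable for the single measure `ℒ² + ℋ¹|A` on `Ω`, to which the
fundamental lemma of the calculus of variations applies. -/
theorem ae_eq_zero_of_forall_integral_add_eq_zero {Ω : Set Plane} (hΩ : IsOpen Ω)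
    {g ψ : Plane → Plane} (hg : IntegrableOn g Ω volume) (hψ : IntegrableOn ψ Ω (μH[1]))
    (h : ∀ φ : Plane → ℝ, ContDiff ℝ ∞ φ → HasCompactSupport φ → tsupport φ ⊆ Ω →
      (∫ x in Ω, φ x • g x) + ∫ x in Ω, φ x • ψ x ∂(μH[1]) = 0) :
    g =ᵐ[volume.restrict Ω] 0 := by
  set ν : Measure Plane := (μH[1] : Measure Plane).restrict Ω with hν
  set lam : Measure Plane := (volume : Measure Plane).restrict Ω with hlam
  set ψ' := hψ.1.mk ψ with hψ'
  have hψm : StronglyMeasurable ψ' := hψ.1.stronglyMeasurable_mk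
  have hae : ψ =ᵐ[ν] ψ' := hψ.1.ae_eq_mk
  have hψi : Integrable ψ' ν := (integrable_congr hae).1 hψ
  set A : Set Plane := {x | ψ' x ≠ 0} with hA
  have hAm : MeasurableSet A := (hψm.measurableSet_eq_fun stronglyMeasurable_zero).compl
  have hA0 : lam A = 0 := by
    -- By Markov's inequality each level set has finite `ℋ¹` measure, so it is Lebesgue null.
    have hU : A ⊆ ⋃ n : ℕ, {x | 1 / ((n : ℝ) + 1) ≤ ‖ψ' x‖} := by
      intro x hx
      obtain ⟨n, hn⟩ := exists_nat_one_div_lt (norm_pos_iff.2 hx)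
      exact mem_iUnion.2 ⟨n, hn.le⟩
    refine measure_mono_null hU (measure_iUnion_null fun n => ?_)
    have hfin := hψi.measure_norm_ge_lt_top (ε := 1 / ((n : ℝ) + 1)) (by positivity)
    rw [hν, Measure.restrict_apply' hΩ.measurableSet] at hfin
    rw [hlam, Measure.restrict_apply' hΩ.measurableSet]
    exact volume_eq_zero_of_hausdorffMeasure_one_lt_top hfin
  classical
  set f : Plane → Plane := A.piecewise ψ' g with hf
  have hfl : f =ᵐ[lam] g := by
    filter_upwards [compl_mem_ae_iff.2 hA0] with x hx
    exact piecewise_eq_of_notMem _ _ _ hx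
  have hfν : f =ᵐ[ν.restrict A] ψ' := by
    filter_upwards [ae_restrict_mem hAm] with x hx
    exact piecewise_eq_of_mem _ _ _ hx
  have i1 : Integrable f lam := (integrable_congr hfl).2 hg
  have i2 : Integrable f (ν.restrict A) := (integrable_congr hfν).2 hψi.restrict
  have hfi : Integrable f (lam + ν.restrict A) := i1.add_measure i2
  suffices key : ∀ᵐ x ∂(lam + ν.restrict A), x ∈ Ω → f x = 0 by
    rw [ae_add_measure_iff] at key
    filter_upwards [key.1, hfl, ae_restrict_mem hΩ.measurableSet] with x hx1 hx2 hx3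
    rw [← hx2, hx1 hx3, Pi.zero_apply]
  refine hΩ.ae_eq_zero_of_integral_contDiff_smul_eq_zero
    (hfi.locallyIntegrable.locallyIntegrableOn Ω) (fun φ h1 h2 h3 => ?_)
  · rw [integral_add_measure (integrable_test_smul i1 h1 h2) (integrable_test_smul i2 h1 h2),
      ← h φ h1 h2 h3]
    congr 1
    · refine integral_congr_ae ?_
      filter_upwards [hfl] with x hx
      rw [hx]
    · have e1 : ∫ x in A, φ x • f x ∂ν = ∫ x in A, φ x • ψ' x ∂ν := by
        refine integral_congr_ae ?_
        filter_upwards [hfν] with x hx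
        rw [hx]
      rw [e1, setIntegral_eq_integral_of_forall_compl_eq_zero]
      · refine integral_congr_ae ?_
        filter_upwards [hae] with x hx
        rw [hx]
      · intro x hx
        rw [not_not.1 hx, smul_zero]

theorem HasDerivParts.congr {Ω : Set Plane} {u v : Plane → ℝ} {g ψ : Plane → Plane}
    (h : HasDerivParts Ω u g ψ) (huv : u =ᵐ[volume.restrict Ω] v) : HasDerivParts Ω v g ψ := by
  refine ⟨h.1, h.2.1, fun φ h1 h2 h3 => ?_⟩
  rw [← h.2.2 φ h1 h2 h3]
  apply integral_congr_ae
  filter_upwards [huv] with x hx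
  rw [hx]

theorem HasDerivParts.add_smul {Ω : Set Plane} {u v : Plane → ℝ} {g ψ g' ψ' : Plane → Plane}
    (hui : IntegrableOn u Ω volume) (hvi : IntegrableOn v Ω volume)
    (hu : HasDerivParts Ω u g ψ) (hv : HasDerivParts Ω v g' ψ') (t : ℝ) :
    HasDerivParts Ω (u + t • v) (g + t • g') (ψ + t • ψ') := by
  refine ⟨hu.1.add (hv.1.smul t), hu.2.1.add (hv.2.1.smul t), fun φ h1 h2 h3 => ?_⟩
  have e1 := hu.2.2 φ h1 h2 h3
  have e2 := hv.2.2 φ h1 h2 h3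
  have l1 : ∀ x, (u + t • v) x • gradient φ x = u x • gradient φ x + t • (v x • gradient φ x) :=
    fun x => by simp only [Pi.add_apply, Pi.smul_apply, smul_eq_mul]; module
  have l2 : ∀ a b : Plane → Plane, ∀ x, φ x • (a + t • b) x = φ x • a x + t • (φ x • b x) :=
    fun a b x => by simp only [Pi.add_apply, Pi.smul_apply]; module
  simp only [l1, l2]
  rw [integral_add (integrable_smul_gradient hui h1 h2), integral_add
    (integrable_test_smul hu.1 h1 h2), integral_add (integrable_test_smul hu.2.1 h1 h2)]
  · simp only [integral_smul, e1, e2]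
    module
  · exact (integrable_test_smul hv.2.1 h1 h2).smul t
  · exact (integrable_test_smul hv.1 h1 h2).smul t
  · exact (integrable_smul_gradient hvi h1 h2).smul t

theorem HasDerivParts.ae_eq {Ω : Set Plane} (hΩ : IsOpen Ω) {u : Plane → ℝ}
    {g ψ g' ψ' : Plane → Plane} (h : HasDerivParts Ω u g ψ) (h' : HasDerivParts Ω u g' ψ') :
    g =ᵐ[volume.restrict Ω] g' := by
  have := ae_eq_zero_of_forall_integral_add_eq_zero hΩ (h.1.sub h'.1) (h.2.1.sub h'.2.1) ?_
  · filter_upwards [this] with x hx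
    exact sub_eq_zero.1 hx
  · intro φ h1 h2 h3
    have e := (h.2.2 φ h1 h2 h3).symm.trans (h'.2.2 φ h1 h2 h3)
    simp only [Pi.sub_apply, smul_sub]
    rw [integral_sub (μ := volume.restrict Ω) (integrable_test_smul h.1 h1 h2)
        (integrable_test_smul h'.1 h1 h2),
      integral_sub (μ := (μH[1]).restrict Ω) (integrable_test_smul h.2.1 h1 h2)
        (integrable_test_smul h'.2.1 h1 h2)]
    rw [← sub_eq_zero, ← neg_eq_zero] at e
    rw [← e]
    module

theorem IsSBV.hasDerivParts_grad {Ω : Set Plane} {u : Plane → ℝ} (h : IsSBV Ω u) :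
    ∃ ψ, HasDerivParts Ω u (grad Ω u) ψ := by
  simpa only [grad, dif_pos h] using h.2.choose_spec

/-- Frees `grad` from the choice in its definition: any decomposition of the derivative computes it.
-/
theorem HasDerivParts.grad_ae_eq {Ω : Set Plane} (hΩ : IsOpen Ω) {u : Plane → ℝ}
    {g ψ : Plane → Plane} (hu : IntegrableOn u Ω volume) (h : HasDerivParts Ω u g ψ) :
    grad Ω u =ᵐ[volume.restrict Ω] g := by
  obtain ⟨ψ', h'⟩ := IsSBV.hasDerivParts_grad ⟨hu, g, ψ, h⟩
  exact h'.ae_eq hΩ h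

theorem IsSBV.congr {Ω : Set Plane} {u v : Plane → ℝ} (h : IsSBV Ω u)
    (huv : u =ᵐ[volume.restrict Ω] v) : IsSBV Ω v := by
  obtain ⟨h1, g, ψ, h2⟩ := h
  exact ⟨(integrable_congr huv).1 h1, g, ψ, h2.congr huv⟩

theorem IsSBV.add_smul {Ω : Set Plane} {u v : Plane → ℝ} (hu : IsSBV Ω u) (hv : IsSBV Ω v)
    (t : ℝ) : IsSBV Ω (u + t • v) := by
  obtain ⟨h1, g, ψ, h2⟩ := hu
  obtain ⟨h1', g', ψ', h2'⟩ := hv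
  exact ⟨h1.add (h1'.smul t), _, _, h2.add_smul h1 h1' h2' t⟩

theorem grad_congr {Ω : Set Plane} (hΩ : IsOpen Ω) {u v : Plane → ℝ} (h : IsSBV Ω u)
    (huv : u =ᵐ[volume.restrict Ω] v) : grad Ω v =ᵐ[volume.restrict Ω] grad Ω u := by
  obtain ⟨ψ, hψ⟩ := h.hasDerivParts_grad
  exact (hψ.congr huv).grad_ae_eq hΩ (h.congr huv).1

theorem grad_add_smul {Ω : Set Plane} (hΩ : IsOpen Ω) {u v : Plane → ℝ} (hu : IsSBV Ω u)
    (hv : IsSBV Ω v) (t : ℝ) :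
    grad Ω (u + t • v) =ᵐ[volume.restrict Ω] grad Ω u + t • grad Ω v := by
  obtain ⟨ψ, h⟩ := hu.hasDerivParts_grad
  obtain ⟨ψ', h'⟩ := hv.hasDerivParts_grad
  exact (h.add_smul hu.1 hv.1 h' t).grad_ae_eq hΩ (hu.add_smul hv t).1

/-! ### Approximate limits and traces -/

theorem HasApproxLimit.congr {Ω : Set Plane} (hΩ : IsOpen Ω) {u v : Plane → ℝ}
    (huv : u =ᵐ[volume.restrict Ω] v) {x : Plane} (hx : x ∈ Ω) {z : ℝ}
    (h : HasApproxLimit u x z) : HasApproxLimit v x z := by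
  refine Tendsto.congr' ?_ h
  obtain ⟨ε, hε, hb⟩ := Metric.isOpen_iff.1 hΩ x hx
  filter_upwards [Ioo_mem_nhdsGT hε] with r hr
  refine average_congr ?_
  filter_upwards [ae_restrict_of_ae_restrict_of_subset
    ((ball_subset_ball hr.2.le).trans hb) huv] with y hy
  rw [hy]

/-- Only averages over small balls inside `Ω` matter, so there is no exceptional set. This is needed
because the representative of a sum in `L²` is only a.e. the sum of representatives. -/
theorem discSet_congr {Ω : Set Plane} (hΩ : IsOpen Ω) {u v : Plane → ℝ}
    (huv : u =ᵐ[volume.restrict Ω] v) : discSet Ω u = discSet Ω v := by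
  ext x
  refine and_congr_right fun hx => not_congr (exists_congr fun z => ?_)
  exact ⟨fun h => h.congr hΩ huv hx, fun h => h.congr hΩ huv.symm hx⟩

theorem HasApproxLimit.add_smul {Ω : Set Plane} (hΩ : IsOpen Ω) {u v : Plane → ℝ}
    (hu : IntegrableOn u Ω volume) (hv : IntegrableOn v Ω volume) {x : Plane} (hx : x ∈ Ω)
    {z w : ℝ} (h : HasApproxLimit u x z) (h' : HasApproxLimit v x w) (t : ℝ) :
    HasApproxLimit (u + t • v) x (z + t * w) := by
  have hlim := Tendsto.add h (Tendsto.const_mul |t| h')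
  simp only [mul_zero, add_zero] at hlim
  obtain ⟨ε, hε, hb⟩ := Metric.isOpen_iff.1 hΩ x hx
  refine squeeze_zero' (Eventually.of_forall fun r => ?_) ?_ hlim
  · rw [setAverage_eq]
    exact smul_nonneg (by positivity) (integral_nonneg fun _ => abs_nonneg _)
  filter_upwards [Ioo_mem_nhdsGT hε] with r hr
  have hsub : ball x r ⊆ Ω := (ball_subset_ball hr.2.le).trans hb
  have hc : ∀ c : ℝ, IntegrableOn (fun _ => c) (ball x r) (volume : Measure Plane) :=
    fun c => integrableOn_const measure_ball_lt_top.ne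
  have iu : IntegrableOn (fun y => |u y - z|) (ball x r) volume :=
    ((hu.mono_set hsub).sub (hc z)).abs
  have iv : IntegrableOn (fun y => |t| * |v y - w|) (ball x r) volume :=
    (((hv.mono_set hsub).sub (hc w)).abs).const_mul _
  simp only [setAverage_eq, smul_eq_mul]
  rw [mul_left_comm, ← mul_add, ← integral_const_mul |t|, ← integral_add iu iv]
  refine mul_le_mul_of_nonneg_left ?_ (by positivity)
  refine integral_mono_of_nonneg (Eventually.of_forall fun _ => abs_nonneg _) (iu.add iv)
    (Eventually.of_forall fun y => ?_)
  simp only [Pi.add_apply, Pi.smul_apply, smul_eq_mul, ← abs_mul]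
  refine le_trans (le_of_eq ?_) (abs_add_le _ _)
  congr 1
  ring

theorem discSet_add_smul_subset {Ω : Set Plane} (hΩ : IsOpen Ω) {u v : Plane → ℝ}
    (hu : IntegrableOn u Ω volume) (hv : IntegrableOn v Ω volume) (t : ℝ) :
    discSet Ω (u + t • v) ⊆ discSet Ω u ∪ discSet Ω v := by
  rintro x ⟨hx, h⟩
  by_contra hn
  simp only [discSet, mem_union, mem_ofPred_eq, hx, true_and, not_or, not_not] at hn
  obtain ⟨⟨z, hz⟩, w, hw⟩ := hn
  exact h ⟨_, hz.add_smul hΩ hu hv hx hw t⟩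

theorem HasTraceAt.congr {Ω : Set Plane} {u v : Plane → ℝ}
    (huv : u =ᵐ[volume.restrict Ω] v) {x : Plane} {a : ℝ}
    (h : HasTraceAt Ω u x a) : HasTraceAt Ω v x a := by
  refine Tendsto.congr (fun r => ?_) h
  congr 1
  refine integral_congr_ae ?_
  filter_upwards [ae_restrict_of_ae_restrict_of_subset inter_subset_left huv] with y hy
  rw [hy]

theorem HasTraceAt.add_smul {Ω : Set Plane} {u v : Plane → ℝ}
    (hu : IntegrableOn u Ω volume) (hv : IntegrableOn v Ω volume) {x : Plane}
    {a b : ℝ} (h : HasTraceAt Ω u x a) (h' : HasTraceAt Ω v x b) (t : ℝ) :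
    HasTraceAt Ω (u + t • v) x (a + t * b) := by
  have hlim := Tendsto.add h (Tendsto.const_mul |t| h')
  simp only [mul_zero, add_zero] at hlim
  refine squeeze_zero (fun r => ?_) (fun r => ?_) hlim
  · exact mul_nonneg (by positivity) (integral_nonneg fun _ => abs_nonneg _)
  have hc : ∀ c : ℝ, IntegrableOn (fun _ => c) (Ω ∩ ball x r) (volume : Measure Plane) :=
    fun c => integrableOn_const ((measure_mono inter_subset_right).trans_lt
      measure_ball_lt_top).ne
  have iu : IntegrableOn (fun y => |u y - a|) (Ω ∩ ball x r) volume :=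
    ((hu.mono_set inter_subset_left).sub (hc a)).abs
  have iv : IntegrableOn (fun y => |t| * |v y - b|) (Ω ∩ ball x r) volume :=
    (((hv.mono_set inter_subset_left).sub (hc b)).abs).const_mul _
  rw [mul_left_comm, ← mul_add, ← integral_const_mul |t|, ← integral_add iu iv]
  refine mul_le_mul_of_nonneg_left ?_ (by positivity)
  refine integral_mono_of_nonneg (Eventually.of_forall fun _ => abs_nonneg _) (iu.add iv)
    (Eventually.of_forall fun y => ?_)
  simp only [Pi.add_apply, Pi.smul_apply, smul_eq_mul, ← abs_mul]
  refine le_trans (le_of_eq ?_) (abs_add_le _ _)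
  congr 1
  ring

theorem traceEq_add_smul {Ω : Set Plane} {u v : Plane → ℝ}
    (hu : IntegrableOn u Ω volume) (hv : IntegrableOn v Ω volume)
    (h : ∀ᵐ x ∂((μH[1] : Measure Plane).restrict (frontier Ω)), HasTraceAt Ω v x 0) (t : ℝ) :
    TraceEq Ω (u + t • v) u := by
  filter_upwards [h] with x hx a
  constructor
  · intro ha
    -- Write `u = (u + tv) - tv`, where `v` has trace `0`. Existence of a trace of `u` is never
    -- assumed.
    have := ha.add_smul (hu.add (hv.smul t)) hv hx (-t)
    rw [mul_zero, add_zero] at this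
    convert this using 1
    module
  · intro ha
    simpa using ha.add_smul hu hv hx t

/-! ### Linear structure of `SBV²` -/

theorem coeFn_add_smul {Ω : Set Plane} (u v : L2 Ω) (t : ℝ) :
    ⇑(u + t • v) =ᵐ[volume.restrict Ω] ⇑u + t • ⇑v := by
  filter_upwards [Lp.coeFn_add u (t • v), Lp.coeFn_smul t v] with x h1 h2
  rw [h1, Pi.add_apply, Pi.add_apply, h2]

theorem grad_coeFn_add_smul {Ω : Set Plane} (hΩ : IsOpen Ω) {u v : L2 Ω} (hu : IsSBV Ω u)
    (hv : IsSBV Ω v) (t : ℝ) :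
    grad Ω ⇑(u + t • v) =ᵐ[volume.restrict Ω] grad Ω u + t • grad Ω v :=
  (grad_congr hΩ (hu.add_smul hv t) (coeFn_add_smul u v t).symm).trans
    (grad_add_smul hΩ hu hv t)

theorem add_smul_mem_SBV2 {Ω : Set Plane} (hΩ : IsOpen Ω) {S : Set Plane} {u v : L2 Ω}
    (hu : u ∈ SBV2 Ω S) (hv : v ∈ SBV2 Ω S) (t : ℝ) : u + t • v ∈ SBV2 Ω S := by
  obtain ⟨hu1, hu2, hu3⟩ := hu
  obtain ⟨hv1, hv2, hv3⟩ := hv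
  refine ⟨(hu1.add_smul hv1 t).congr (coeFn_add_smul u v t).symm,
    (hu2.add (hv2.const_smul t)).ae_eq (grad_coeFn_add_smul hΩ hu1 hv1 t).symm, ?_⟩
  unfold SubsetH1
  rw [discSet_congr hΩ (coeFn_add_smul u v t)]
  refine measure_mono_null (sdiff_subset_sdiff_left
    (discSet_add_smul_subset hΩ hu1.1 hv1.1 t)) ?_
  rw [union_sdiff_distrib]
  exact measure_union_null hu3 hv3

theorem traceEq_coeFn_add_smul {Ω : Set Plane} {u v : L2 Ω} (hu : IsSBV Ω u) (hv : IsSBV Ω v)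
    (h : ∀ᵐ x ∂((μH[1] : Measure Plane).restrict (frontier Ω)), HasTraceAt Ω v x 0) (t : ℝ) :
    TraceEq Ω ⇑(u + t • v) u := by
  filter_upwards [traceEq_add_smul hu.1 hv.1 h t] with x hx a
  rw [← hx a]
  exact ⟨fun h => h.congr (coeFn_add_smul u v t), fun h => h.congr (coeFn_add_smul u v t).symm⟩

theorem add_smul_mem_SBV2Zero {Ω : Set Plane} (hΩ : IsOpen Ω) {S : Set Plane} {u v : L2 Ω}
    (hu : u ∈ SBV2Zero Ω S) (hv : v ∈ SBV2Zero Ω S) (t : ℝ) : u + t • v ∈ SBV2Zero Ω S := by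
  refine ⟨add_smul_mem_SBV2 hΩ hu.1 hv.1 t, ?_⟩
  filter_upwards [traceEq_coeFn_add_smul hu.1.1 hv.1.1 hv.2 t, hu.2] with x hx hx0
  exact (hx 0).2 hx0

theorem integrable_inner_of_memLp {μ : Measure Plane} {f g : Plane → Plane} (hf : MemLp f 2 μ)
    (hg : MemLp g 2 μ) : Integrable (fun x => ⟪f x, g x⟫) μ :=
  (hf.norm.integrable_mul hg.norm).mono (hf.1.inner hg.1) (Eventually.of_forall fun x => by
    simpa using abs_real_inner_le_norm (f x) (g x))

theorem gradInner_add_smul {Ω : Set Plane} (hΩ : IsOpen Ω) {S : Set Plane} {w u v : L2 Ω}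
    (hw : w ∈ SBV2 Ω S) (hu : u ∈ SBV2 Ω S) (hv : v ∈ SBV2 Ω S) (t : ℝ) :
    gradInner Ω w ⇑(u + t • v) = gradInner Ω w u + t * gradInner Ω w v := by
  unfold gradInner
  rw [← integral_const_mul, ← integral_add (integrable_inner_of_memLp hw.2.1 hu.2.1)
    ((integrable_inner_of_memLp hw.2.1 hv.2.1).const_mul t)]
  refine integral_congr_ae ?_
  filter_upwards [grad_coeFn_add_smul hΩ hu.1 hv.1 t] with x hx
  rw [hx, Pi.add_apply, Pi.smul_apply, inner_add_right, inner_smul_right]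

theorem gradInner_comm (Ω : Set Plane) (u v : Plane → ℝ) :
    gradInner Ω u v = gradInner Ω v u := by
  simp only [gradInner, real_inner_comm]

/-! ### The energy along a line -/

theorem lintegral_enorm_grad {Ω S : Set Plane} {u : L2 Ω} (hu : u ∈ SBV2 Ω S) :
    ∫⁻ x in Ω, ‖grad Ω u x‖ₑ ^ 2 = ENNReal.ofReal (gradInner Ω u u) := by
  unfold gradInner
  rw [ofReal_integral_eq_lintegral_ofReal (integrable_inner_of_memLp hu.2.1 hu.2.1)
    (Eventually.of_forall fun x => real_inner_self_nonneg)]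
  refine lintegral_congr fun x => ?_
  rw [real_inner_self_eq_norm_sq, ENNReal.ofReal_pow (norm_nonneg _), ofReal_norm]

theorem energy_union_discSet {Ω S : Set Plane} {u : L2 Ω} (hu : u ∈ SBV2 Ω S) :
    energy Ω u (S ∪ discSet Ω u) = ENNReal.ofReal (gradInner Ω u u) + μH[1] S := by
  rw [energy, lintegral_enorm_grad hu, ← union_sdiff_self]
  congr 1
  refine le_antisymm ((measure_union_le _ _).trans ?_) (measure_mono subset_union_left)
  rw [show μH[1] (discSet Ω u \ S) = 0 from hu.2.2, add_zero]

/-- Expand the square `‖∇u + t∇φ‖²`. Cancelling `ℋ¹(S)` in `[0, ∞]` requires its finiteness; the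
positive part is hidden in `ENNReal.ofReal`. -/
theorem quotient_add_smul {Ω : Set Plane} (hΩ : IsOpen Ω) {S : Set Plane} (hS : μH[1] S < ⊤)
    {u φ : L2 Ω} (hu : u ∈ SBV2 Ω S) (hφ : φ ∈ SBV2 Ω S) (hφ0 : φ ≠ 0) {t : ℝ} (ht : 0 < t) :
    quotient Ω S u (u + t • φ) =
      ENNReal.ofReal ((-2 * gradInner Ω u φ - t * gradInner Ω φ φ) / ‖φ‖) := by
  have hv := add_smul_mem_SBV2 hΩ hu hφ t
  have hn : 0 < ‖φ‖ := norm_pos_iff.2 hφ0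
  have h0 : 0 ≤ gradInner Ω ⇑(u + t • φ) ⇑(u + t • φ) :=
    integral_nonneg fun x => real_inner_self_nonneg
  rw [quotient, energy_union_discSet hv, energy, lintegral_enorm_grad hu,
    ENNReal.add_sub_add_eq_sub_right hS.ne, ← ENNReal.ofReal_sub _ h0, add_sub_cancel_left,
    ← ofReal_norm, ← ENNReal.ofReal_div_of_pos
      (by rw [norm_smul, Real.norm_of_nonneg ht.le]; positivity), norm_smul, Real.norm_of_nonneg ht.le, gradInner_add_smul hΩ hv hu hφ,
    gradInner_comm Ω ⇑(u + t • φ) u, gradInner_comm Ω ⇑(u + t • φ) φ,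
    gradInner_add_smul hΩ hu hu hφ,
    gradInner_add_smul hΩ hφ hu hφ, gradInner_comm Ω φ u]
  congr 1
  field_simp
  ring

/-- The upper limit along the half-line `t ↓ 0` is at most the full one. The set `s` of competitors
is left free so as to serve both slopes. -/
theorem neg_two_mul_gradInner_le {Ω : Set Plane} (hΩ : IsOpen Ω) {S : Set Plane}
    (hS : μH[1] S < ⊤) {u φ : L2 Ω} (hu : u ∈ SBV2 Ω S) (hφ : φ ∈ SBV2 Ω S) {s : Set (L2 Ω)}
    (hs : φ ≠ 0 → ∀ t > (0 : ℝ), u + t • φ ∈ s) (hL : limsup (quotient Ω S u) (𝓝[s] u) < ⊤) :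
    -2 * gradInner Ω u φ ≤ (limsup (quotient Ω S u) (𝓝[s] u)).toReal * ‖φ‖ := by
  rcases eq_or_ne φ 0 with rfl | hφ0
  -- For `φ = 0`, additivity reads `a = a + a`, so `a = 0`.
  · have h := gradInner_add_smul hΩ hu hφ hφ 1
    simp only [smul_zero, add_zero, one_mul, left_eq_add] at h
    rw [h, mul_zero, norm_zero, mul_zero]
  have hn : 0 < ‖φ‖ := norm_pos_iff.2 hφ0
  have hm : Tendsto (fun t : ℝ => u + t • φ) (𝓝[>] 0) (𝓝[s] u) := by
    refine tendsto_nhdsWithin_iff.2 ⟨?_, ?_⟩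
    · have : Continuous fun t : ℝ => u + t • φ := by fun_prop
      have h := this.tendsto 0
      simp only [zero_smul, add_zero] at h
      exact h.mono_left nhdsWithin_le_nhds
    · filter_upwards [self_mem_nhdsWithin] with t ht
      exact hs hφ0 t ht
  have hq : Tendsto (fun t : ℝ => quotient Ω S u (u + t • φ)) (𝓝[>] 0)
      (𝓝 (ENNReal.ofReal ((-2 * gradInner Ω u φ) / ‖φ‖))) := by
    have hc : Continuous fun t : ℝ =>
        ENNReal.ofReal ((-2 * gradInner Ω u φ - t * gradInner Ω φ φ) / ‖φ‖) :=
      ENNReal.continuous_ofReal.comp (by fun_prop)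
    have h := hc.tendsto 0
    simp only [zero_mul, sub_zero] at h
    refine (h.mono_left nhdsWithin_le_nhds).congr' ?_
    filter_upwards [self_mem_nhdsWithin] with t ht
    exact (quotient_add_smul hΩ hS hu hφ hφ0 ht).symm
  have hle : ENNReal.ofReal ((-2 * gradInner Ω u φ) / ‖φ‖) ≤
      limsup (quotient Ω S u) (𝓝[s] u) := by
    rw [← hq.limsup_eq]
    exact limsup_le_limsup_of_le hm
  rw [← div_le_iff₀ hn]
  exact (ENNReal.ofReal_le_iff_le_toReal hL.ne).1 hle

theorem zero_mem_of_add_smul_mem {E : Type*} [AddCommGroup E] [Module ℝ E] {K : Set E}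
    (hK : ∀ u ∈ K, ∀ v ∈ K, ∀ t : ℝ, u + t • v ∈ K) {u : E} (hu : u ∈ K) : (0 : E) ∈ K := by
  simpa using hK u hu u hu (-1)

theorem two_mul_abs_gradInner_le {Ω : Set Plane} (hΩ : IsOpen Ω) {S : Set Plane}
    (hS : μH[1] S < ⊤) {u φ : L2 Ω} (hu : u ∈ SBV2 Ω S) (hφ : φ ∈ SBV2 Ω S) {s : Set (L2 Ω)}
    (hs : φ ≠ 0 → ∀ t ≠ (0 : ℝ), u + t • φ ∈ s) (hL : limsup (quotient Ω S u) (𝓝[s] u) < ⊤) :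
    2 * |gradInner Ω u φ| ≤ (limsup (quotient Ω S u) (𝓝[s] u)).toReal * ‖φ‖ := by
  have h0 : (0 : L2 Ω) ∈ SBV2 Ω S :=
    zero_mem_of_add_smul_mem (fun _ h _ h' t => add_smul_mem_SBV2 hΩ h h' t) hu
  have hg0 : gradInner Ω u ⇑(0 : L2 Ω) = 0 := by
    simpa using gradInner_add_smul hΩ hu h0 h0 1
  have hneg : (-1 : ℝ) • φ ∈ SBV2 Ω S := by
    simpa only [zero_add] using add_smul_mem_SBV2 hΩ h0 hφ (-1)
  have e : gradInner Ω u ⇑((-1 : ℝ) • φ) = -gradInner Ω u φ := by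
    have h := gradInner_add_smul hΩ hu h0 hφ (-1)
    rw [hg0, zero_add, zero_add, neg_one_mul] at h
    exact h
  have h1 := neg_two_mul_gradInner_le hΩ hS hu hφ (fun h t ht => hs h t ht.ne') hL
  have h2 := neg_two_mul_gradInner_le hΩ hS hu hneg (s := s) (fun h t ht => by
    rw [smul_smul]
    exact hs (fun h' => h (by rw [h', smul_zero])) _ (by simpa using ht.ne')) hL
  rw [e, norm_smul, norm_neg, norm_one, one_mul] at h2
  rcases abs_cases (gradInner Ω u φ) with h | h <;> linarith [h.1]

/-! ### Test functions -/

theorem hasDerivParts_of_contDiff {Ω : Set Plane} {h : Plane → ℝ} (h1 : ContDiff ℝ ∞ h)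
    (h2 : HasCompactSupport h) (h3 : tsupport h ⊆ Ω) : HasDerivParts Ω h (gradient h) 0 := by
  refine ⟨((continuous_gradient h1).integrable_of_hasCompactSupport
    (hasCompactSupport_gradient h2)).integrableOn, integrable_zero _ _ _, fun φ g1 g2 g3 => ?_⟩
  have z : ∀ {f : Plane → ℝ}, tsupport f ⊆ Ω → ∀ x ∉ Ω, f x = 0 := fun hf x hx =>
    image_eq_zero_of_notMem_tsupport fun h => hx (hf h)
  rw [setIntegral_eq_integral_of_forall_compl_eq_zero (fun x hx => by rw [z h3 x hx, zero_smul]),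
    setIntegral_eq_integral_of_forall_compl_eq_zero (fun x hx => by rw [z g3 x hx, zero_smul])]
  simp only [Pi.zero_apply, smul_zero, integral_zero, sub_zero]
  have hi : ∀ {f : Plane → ℝ}, ContDiff ℝ ∞ f → HasCompactSupport f →
      Integrable f (volume : Measure Plane) :=
    fun a b => a.continuous.integrable_of_hasCompactSupport b
  have i1 := integrable_smul_gradient (hi h1 h2) g1 g2
  have i2 := integrable_smul_gradient (hi g1 g2) h1 h2
  have hg : ∀ (f : Plane → ℝ) (x v : Plane), ⟪v, gradient f x⟫ = fderiv ℝ f x v := by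
    intro f x v
    rw [real_inner_comm, gradient, InnerProductSpace.toDual_symm_apply]
  -- Pairing with a constant vector `v` reduces the claim to scalar integration by parts in the
  -- direction `v`.
  refine ext_inner_left ℝ fun v => ?_
  rw [inner_neg_right, ← integral_inner (𝕜 := ℝ) i1, ← integral_inner (𝕜 := ℝ) i2]
  simp only [inner_smul_right, hg]
  have j1 := i1.const_inner (𝕜 := ℝ) v
  have j2 := i2.const_inner (𝕜 := ℝ) v
  simp only [inner_smul_right, hg] at j1 j2
  rw [integral_mul_fderiv_eq_neg_fderiv_mul_of_integrable (by simpa only [mul_comm] using j2) j1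
    ((h1.mul g1).continuous.integrable_of_hasCompactSupport h2.mul_right)
    (fun x _ => h1.contDiffAt.differentiableAt (by simp))
    (fun x _ => g1.contDiffAt.differentiableAt (by simp))]
  simp only [mul_comm]

theorem hasApproxLimit_of_continuous {h : Plane → ℝ} (hc : Continuous h) (x : Plane) :
    HasApproxLimit h x (h x) := by
  refine Metric.tendsto_nhds.2 fun ε hε => ?_
  obtain ⟨δ, hδ, hb⟩ := Metric.continuous_iff.1 hc x (ε / 2) (half_pos hε)
  filter_upwards [Ioo_mem_nhdsGT hδ] with r hr
  have hn : 0 ≤ ⨍ y in ball x r, |h y - h x| := by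
    rw [setAverage_eq]
    exact smul_nonneg (by positivity) (integral_nonneg fun _ => abs_nonneg _)
  have hv : 0 < volume.real (ball x r) :=
    ENNReal.toReal_pos (measure_ball_pos _ _ hr.1).ne' measure_ball_lt_top.ne
  rw [Real.dist_eq, sub_zero, abs_of_nonneg hn, setAverage_eq, smul_eq_mul]
  refine lt_of_le_of_lt ?_ (half_lt_self hε)
  rw [inv_mul_le_iff₀ hv]
  have hle := norm_setIntegral_le_of_norm_le_const (μ := (volume : Measure Plane))
    (s := ball x r) (f := fun y => |h y - h x|) (C := ε / 2) measure_ball_lt_top (fun y hy => by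
      rw [Real.norm_eq_abs, abs_abs, ← Real.dist_eq]
      exact (hb y ((mem_ball.1 hy).trans hr.2)).le)
  rw [mul_comm]
  exact (le_abs_self _).trans hle

theorem hasTraceAt_zero_of_tsupport_subset {Ω : Set Plane} (hΩ : IsOpen Ω) {h : Plane → ℝ}
    (hs : tsupport h ⊆ Ω) {x : Plane} (hx : x ∈ frontier Ω) : HasTraceAt Ω h x 0 := by
  have hx' : x ∈ (tsupport h)ᶜ := fun hxs => by
    rw [hΩ.frontier_eq] at hx
    exact hx.2 (hs hxs)
  obtain ⟨ε, hε, hb⟩ := Metric.isOpen_iff.1 (isClosed_tsupport h).isOpen_compl x hx'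
  refine tendsto_const_nhds.congr' ?_
  filter_upwards [Ioo_mem_nhdsGT hε] with r hr
  rw [setIntegral_eq_zero_of_forall_eq_zero, mul_zero]
  intro y hy
  rw [image_eq_zero_of_notMem_tsupport (hb (ball_subset_ball hr.2.le hy.2)), sub_zero, abs_zero]

theorem toLp_mem_SBV2Zero {Ω : Set Plane} (hΩ : IsOpen Ω) (S : Set Plane) {h : Plane → ℝ}
    (h1 : ContDiff ℝ ∞ h) (h2 : HasCompactSupport h) (h3 : tsupport h ⊆ Ω)
    (hm : MemLp h 2 (volume.restrict Ω)) : hm.toLp h ∈ SBV2Zero Ω S := by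
  have hae : h =ᵐ[volume.restrict Ω] hm.toLp h := hm.coeFn_toLp.symm
  have hi : IntegrableOn h Ω volume :=
    (h1.continuous.integrable_of_hasCompactSupport h2).integrableOn
  have hd := hasDerivParts_of_contDiff h1 h2 h3
  have hsbv : IsSBV Ω h := ⟨hi, _, _, hd⟩
  refine ⟨⟨hsbv.congr hae, ?_, ?_⟩, ?_⟩
  · have hg := (grad_congr hΩ hsbv hae).trans (hd.grad_ae_eq hΩ hi)
    exact (((continuous_gradient h1).memLp_of_hasCompactSupport
      (hasCompactSupport_gradient h2)).restrict Ω).ae_eq hg.symm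
  · unfold SubsetH1
    rw [← discSet_congr hΩ hae]
    have : discSet Ω h = ∅ := by
      ext x
      simp only [discSet, mem_ofPred_eq, mem_empty_iff_false, iff_false, not_and, not_not]
      exact fun _ => ⟨_, hasApproxLimit_of_continuous h1.continuous x⟩
    rw [this, empty_sdiff, measure_empty]
  · filter_upwards [ae_restrict_mem isClosed_frontier.measurableSet] with x hx
    exact (hasTraceAt_zero_of_tsupport_subset hΩ h3 hx).congr hae

/-! ### The spaces as subspaces of `L²` -/

theorem zero_mem_SBV2Zero {Ω : Set Plane} (hΩ : IsOpen Ω) (S : Set Plane) :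
    (0 : L2 Ω) ∈ SBV2Zero Ω S := by
  have h0 : tsupport (0 : Plane → ℝ) = ∅ := tsupport_eq_empty_iff.2 rfl
  have h := toLp_mem_SBV2Zero hΩ S (h := 0) contDiff_const HasCompactSupport.zero
    (by rw [h0]; exact empty_subset _) MemLp.zero'
  rwa [show MemLp.toLp (0 : Plane → ℝ) _ = (0 : L2 Ω) from MemLp.toLp_zero _] at h

/-- `SBV²(Ω, S)` as a subspace of `L²(Ω)`. -/
def submoduleSBV2 {Ω : Set Plane} (hΩ : IsOpen Ω) (S : Set Plane) : Submodule ℝ (L2 Ω) where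
  carrier := SBV2 Ω S
  zero_mem' := (zero_mem_SBV2Zero hΩ S).1
  add_mem' {u v} hu hv := by simpa using add_smul_mem_SBV2 hΩ hu hv 1
  smul_mem' t u hu := by
    simpa using add_smul_mem_SBV2 hΩ (zero_mem_SBV2Zero hΩ S).1 hu t

/-- `SBV²₀(Ω, S)` as a subspace of `L²(Ω)`. -/
def submoduleSBV2Zero {Ω : Set Plane} (hΩ : IsOpen Ω) (S : Set Plane) :
    Submodule ℝ (L2 Ω) where
  carrier := SBV2Zero Ω S
  zero_mem' := zero_mem_SBV2Zero hΩ S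
  add_mem' {u v} hu hv := by simpa using add_smul_mem_SBV2Zero hΩ hu hv 1
  smul_mem' t u hu := by
    simpa using add_smul_mem_SBV2Zero hΩ (zero_mem_SBV2Zero hΩ S) hu t

/-- A vector orthogonal to the subspace is orthogonal to every test function, hence zero a.e. on
`Ω`. -/
theorem topologicalClosure_submoduleSBV2Zero {Ω : Set Plane} (hΩ : IsOpen Ω) (S : Set Plane) :
    (submoduleSBV2Zero hΩ S).topologicalClosure = ⊤ := by
  rw [Submodule.topologicalClosure_eq_top_iff, Submodule.eq_bot_iff]
  intro w hw
  have hz : ∀ᵐ x ∂(volume.restrict Ω), x ∈ Ω → w x = 0 := by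
    refine hΩ.ae_eq_zero_of_integral_contDiff_smul_eq_zero
      (((Lp.memLp w).locallyIntegrable (by norm_num)).locallyIntegrableOn Ω) ?_
    intro h h1 h2 h3
    have hm : MemLp h 2 (volume.restrict Ω) :=
      (h1.continuous.memLp_of_hasCompactSupport h2).restrict Ω
    have := (Submodule.mem_orthogonal _ _).1 hw _ (toLp_mem_SBV2Zero hΩ S h1 h2 h3 hm)
    rw [L2.inner_def] at this
    rw [← this]
    refine integral_congr_ae ?_
    filter_upwards [hm.coeFn_toLp] with x hx
    rw [hx, real_inner_eq_re_inner]
    simp [mul_comm]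
  rw [Lp.eq_zero_iff_ae_eq_zero]
  filter_upwards [hz, ae_restrict_mem hΩ.measurableSet] with x hx hx'
  exact hx hx'

/-- A linear functional `ℓ` on a subspace `W` of a Hilbert space which is bounded by `C` is
represented on `W` by a vector of norm at most `C`. -/
theorem exists_inner_eq_of_bound {E : Type*} [NormedAddCommGroup E] [InnerProductSpace ℝ E]
    [CompleteSpace E] (W : Submodule ℝ E) (l : W →ₗ[ℝ] ℝ) {C : ℝ} (hC : 0 ≤ C)
    (h : ∀ x : W, |l x| ≤ C * ‖(x : E)‖) :
    ∃ f : E, (∀ x : W, l x = ⟪f, (x : E)⟫) ∧ ‖f‖ ≤ C := by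
  -- Hahn-Banach first, since `W` need not be closed; then Riesz on the whole space.
  obtain ⟨g, hg, hgn⟩ := exists_extension_norm_eq W (l.mkContinuous C h)
  refine ⟨(InnerProductSpace.toDual ℝ E).symm g, fun x => ?_, ?_⟩
  · rw [InnerProductSpace.toDual_symm_apply, hg x]
    rfl
  · rw [LinearIsometryEquiv.norm_map, hgn]
    exact LinearMap.mkContinuous_norm_le _ hC _

/-- The functional `φ ↦ (∇u | ∇φ)` on `SBV²(Ω, S)`. -/
noncomputable def gradInnerₗ {Ω : Set Plane} (hΩ : IsOpen Ω) {S : Set Plane} {u : L2 Ω}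
    (hu : u ∈ SBV2 Ω S) : submoduleSBV2 hΩ S →ₗ[ℝ] ℝ where
  toFun φ := gradInner Ω u (φ : L2 Ω)
  map_add' φ ψ := by
    simpa using gradInner_add_smul hΩ hu φ.2 ψ.2 1
  map_smul' t φ := by
    have h0 := (zero_mem_SBV2Zero hΩ S).1
    have hg0 : gradInner Ω u ⇑(0 : L2 Ω) = 0 := by
      simpa using gradInner_add_smul hΩ hu h0 h0 1
    have h := gradInner_add_smul hΩ hu h0 φ.2 t
    rw [hg0, zero_add, zero_add] at h
    exact h

end MumfordShah

open MumfordShah in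
theorem proposition1 (Ω : Set MumfordShah.Plane) (hΩ : IsOpen Ω)
    (hΩb : Bornology.IsBounded Ω) (hΩc : MumfordShah.HasC1Boundary Ω)
    (S : Set MumfordShah.Plane) (hSΩ : S ⊆ Ω) (hS : μH[1] S < ⊤)
    (u : MumfordShah.L2 Ω) (hu : u ∈ MumfordShah.SBV2 Ω S)
    (hslope : MumfordShah.slopeB Ω S u < ⊤) :
    ∃ f : MumfordShah.L2 Ω,
      (∀ φ ∈ MumfordShah.SBV2Zero Ω S, MumfordShah.gradInner Ω u φ = ⟪f, φ⟫) ∧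
      2 * ‖f‖ₑ ≤ MumfordShah.slopeB Ω S u ∧
      (MumfordShah.slope Ω S u < ⊤ →
        ∀ φ ∈ MumfordShah.SBV2 Ω S, MumfordShah.gradInner Ω u φ = ⟪f, φ⟫) := by
  have hne : ∀ φ : L2 Ω, φ ≠ 0 → ∀ t ≠ (0 : ℝ), u + t • φ ≠ u := fun φ h t ht => by
    simpa using ⟨ht, h⟩
  have hle : submoduleSBV2Zero hΩ S ≤ submoduleSBV2 hΩ S := fun φ hφ => hφ.1
  obtain ⟨f, hf, hfn⟩ := exists_inner_eq_of_bound (submoduleSBV2Zero hΩ S)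
    ((gradInnerₗ hΩ hu).comp (Submodule.inclusion hle)) (C := (slopeB Ω S u).toReal / 2)
    (by positivity) (fun φ => by
      have h := two_mul_abs_gradInner_le hΩ hS hu φ.2.1
        (s := {v : L2 Ω | IsSBV Ω v ∧ TraceEq Ω v u ∧ v ≠ u})
        (fun h t ht => ⟨(add_smul_mem_SBV2 hΩ hu φ.2.1 t).1,
          traceEq_coeFn_add_smul hu.1 φ.2.1.1 φ.2.2 t, hne _ h t ht⟩) hslope
      change |gradInner Ω u (φ : L2 Ω)| ≤ (slopeB Ω S u).toReal / 2 * ‖(φ : L2 Ω)‖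
      unfold slopeB
      linarith)
  refine ⟨f, fun φ hφ => hf ⟨φ, hφ⟩, ?_, fun hsl φ hφ => ?_⟩
  · rw [← ENNReal.ofReal_toReal hslope.ne, ← ofReal_norm, two_mul,
      ← ENNReal.ofReal_add (norm_nonneg _) (norm_nonneg _)]
    exact ENNReal.ofReal_le_ofReal (by linarith)
  -- The norm bound on `f'` is dropped: `f'` only has to be identified with `f`, by density of
  -- `SBV²₀(Ω, S)`.
  · obtain ⟨f', hf', -⟩ := exists_inner_eq_of_bound (submoduleSBV2 hΩ S)
      (gradInnerₗ hΩ hu) (C := (MumfordShah.slope Ω S u).toReal / 2) (by positivity) (fun φ => by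
        have h := two_mul_abs_gradInner_le hΩ hS hu φ.2
          (s := {v : L2 Ω | IsSBV Ω v ∧ v ≠ u})
          (fun h t ht => ⟨(add_smul_mem_SBV2 hΩ hu φ.2 t).1, hne _ h t ht⟩) hsl
        change |gradInner Ω u (φ : L2 Ω)| ≤ (MumfordShah.slope Ω S u).toReal / 2 * ‖(φ : L2 Ω)‖
        unfold MumfordShah.slope
        linarith)
    have horth : f' - f ∈ (submoduleSBV2Zero hΩ S)ᗮ := by
      refine (Submodule.mem_orthogonal' _ _).2 fun ψ hψ => ?_
      rw [inner_sub_left, sub_eq_zero]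
      exact (hf' ⟨ψ, hle hψ⟩).symm.trans (hf ⟨ψ, hψ⟩)
    rw [Submodule.topologicalClosure_eq_top_iff.1 (topologicalClosure_submoduleSBV2Zero hΩ S),
      Submodule.mem_bot, sub_eq_zero] at horth
    rw [← horth]
    exact hf' ⟨φ, hφ⟩
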